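/- Let $G$ be a connected undirected simple graph on the nodes $1,\dots,n$, and let $\mathcal E$ be the set of ordered pairs $(i,j)$ of neighbours (each edge in both orientations), $|\mathcal E|=m_{\mathcal E}$. Let $A_s,A_d\in\mathbb R^{m_{\mathcal E}p\times np}$ be the block source and destination matrices: for $e=(i,j)\in\mathcal E$ the only nonzero $p\times p$ block in row $e$ of $A_s$ (of $A_d$) is $I_p$ in column $i$ (in column $j$). Put $A=[A_s;A_d]$, $B=[-I;-I]$, $E_o=A_s-A_d$, $E_u=A_s+A_d$, and let $\gamma_u$ be the smallest singular value of $E_u$, assumed positive. Let $f_1,\dots,f_n:\mathbb R^p\to\mathbb R$ be twice differentiable with $mI\preceq\nabla^2f_i(x)\preceq MI$ for all $x$, where $0<m\le M<\infty$, and with $\|\nabla^2f_i(x)-\nabla^2f_i(\hat x)\|\le L\|x-\hat x\|$ for all $x,\hat x$. For $x=[x_1;\dots;x_n]$ let $f(x)=\sum_{i=1}^nf_i(x_i)$, let $c>0$, and let $$\mathcal L(x,z,\lambda)=f(x)+\lambda^T(Ax+Bz)+\tfrac c2\|Ax+Bz\|^2 .$$ Let $(x^*,z^*)$ be the solution of $\min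 f(x)$ subject to $x_i=z_{ij}$, $x_j=z_{ij}$ for all $(i,j)\in\mathcal E$, and let $\alpha^*$ be the optimal multiplier in the column space of $E_o$, that is, $(x^*,z^*)$ minimizes $\mathcal L(\cdot,\cdot,[\alpha^*;\beta^*])$ for some $\beta^*$. Let $(x_k,z_k,\lambda_k)_{k\ge0}$, $\lambda_k=[\alpha_k;\beta_k]$, be generated by the DQM method: with $H_k=\nabla^2f(x_k)$, $$x_{k+1}=\arg\min_x\ f(x_k)+\nabla f(x_k)^T(x-x_k)+\tfrac12(x-x_k)^TH_k(x-x_k)+\lambda_k^T(Ax+Bz_k)+\tfrac c2\|Ax+Bz_k\|^2,$$ $$z_{k+1}=\arg\min_z\ \mathcal L(x_{k+1},z,\lambda_k),\qquad \lambda_{k+1}=\lambda_k+c(Ax_{k+1}+Bz_{k+1}),$$ where the initial vectors satisfy $\alpha_0=-\beta_0$, $E_ux_0=2z_0$, and $\alpha_0$ lies in the column space of $E_o$. Let $\zeta_k=\min\{\tfrac L2\|x_{k+1}-x_k\|,\,2M\}$ and assume that $c>\zeta_k^2/(m\gamma_u^2)$ for all $k\ge0$. Write $u_k=[z_k;\alpha_k]$,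 $u^*=[z^*;\alpha^*]$, and $\|u\|_C^2=u^TCu$ with $C=\mathrm{diag}(cI,\tfrac1cI)$. Then for all $k\ge0$ $$\|x_k-x^*\|^2\le\frac{4}{c\gamma_u^2}\,\|u_k-u^*\|_C^2,$$ and $\|x_k-x^*\|^2$ converges R-linearly to zero: there are nonnegative $b_k$ with $\|x_k-x^*\|^2\le b_k$ for all $k$, and $\rho\in(0,1)$ with $b_{k+1}\le\rho\,b_k$ for all $k$. -/

import Mathlib

open scoped InnerProductSpace Gradient

noncomputable section

namespace DQM

/-- Stacked node variables `x = [x_1; …; x_n]` in `ℝ^{np}`, with the Euclidean norm. -/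
abbrev NodeVec (n p : ℕ) : Type := EuclideanSpace ℝ (Fin n × Fin p)

/-- Stacked edge variables `z = [z_1; …; z_m]` in `ℝ^{mp}`. The edge set is the set of ordered
pairs of neighbours: an undirected edge contributes both of its orientations. -/
abbrev EdgeVec {n : ℕ} (G : SimpleGraph (Fin n)) (p : ℕ) : Type :=
  EuclideanSpace ℝ (G.Dart × Fin p)

/-- Two stacked edge variables, i.e. vectors in `ℝ^{2mp}` such as `[α; β]` or `[z; α]`. -/
abbrev EdgePair {n : ℕ} (G : SimpleGraph (Fin n)) (p : ℕ) : Type :=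
  EuclideanSpace ℝ ((G.Dart × Fin p) ⊕ (G.Dart × Fin p))

section Blocks

variable {n p : ℕ} {G : SimpleGraph (Fin n)}

/-- The local copy `x_i ∈ ℝ^p` of node `i`. -/
def nodeBlock (x : NodeVec n p) (i : Fin n) : EuclideanSpace ℝ (Fin p) :=
  WithLp.toLp 2 fun a => x (i, a)

/-- The auxiliary variable `z_e ∈ ℝ^p` of the edge `e`. -/
def edgeBlock (z : EdgeVec G p) (e : G.Dart) : EuclideanSpace ℝ (Fin p) :=
  WithLp.toLp 2 fun a => z (e, a)

/-- The stacked vector `[v; w]`. -/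
def stack (v w : EdgeVec G p) : EdgePair G p :=
  WithLp.toLp 2 (Sum.elim (fun i => v i) (fun i => w i))

/-- The first component `α` of `λ = [α; β]`. -/
def fstPart (l : EdgePair G p) : EdgeVec G p := WithLp.toLp 2 fun i => l (Sum.inl i)

/-- The second component `β` of `λ = [α; β]`. -/
def sndPart (l : EdgePair G p) : EdgeVec G p := WithLp.toLp 2 fun i => l (Sum.inr i)

/-- The aggregate objective `f(x) = ∑ i, f_i(x_i)`. -/
def aggregate (f : Fin n → EuclideanSpace ℝ (Fin p) → ℝ) (x : NodeVec n p) : ℝ :=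
  ∑ i, f i (nodeBlock x i)

/-- The constraints `x_i = z_ij`, `x_j = z_ij` for every edge `(i, j)`. -/
def Feasible (x : NodeVec n p) (z : EdgeVec G p) : Prop :=
  ∀ e : G.Dart, nodeBlock x e.fst = edgeBlock z e ∧ nodeBlock x e.snd = edgeBlock z e

/-- `(x, z)` solves `min ∑ i, f_i(x_i)` subject to `x_i = z_ij`, `x_j = z_ij` for all edges. -/
def IsSolution (f : Fin n → EuclideanSpace ℝ (Fin p) → ℝ)
    (x : NodeVec n p) (z : EdgeVec G p) : Prop :=
  Feasible x z ∧ ∀ (x' : NodeVec n p) (z' : EdgeVec G p), Feasible x' z' →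
    aggregate f x ≤ aggregate f x'

end Blocks

section Matrices

variable {n : ℕ} (G : SimpleGraph (Fin n)) [DecidableRel G.Adj] (p : ℕ)

/-- Block source matrix: the block `(e, i)` is `I_p` if `i` is the source of `e`, else `0`. -/
def As : Matrix (G.Dart × Fin p) (Fin n × Fin p) ℝ :=
  Matrix.of fun r s => if r.1.fst = s.1 ∧ r.2 = s.2 then 1 else 0

/-- Block destination matrix: the block `(e, i)` is `I_p` if `i` is the destination of `e`,
else `0`. -/
def Ad : Matrix (G.Dart × Fin p) (Fin n × Fin p) ℝ :=
  Matrix.of fun r s => if r.1.snd = s.1 ∧ r.2 = s.2 then 1 else 0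

/-- `A = [A_s; A_d]`. -/
def A : Matrix ((G.Dart × Fin p) ⊕ (G.Dart × Fin p)) (Fin n × Fin p) ℝ :=
  Matrix.fromRows (As G p) (Ad G p)

/-- `B = [-I; -I]`. -/
def B : Matrix ((G.Dart × Fin p) ⊕ (G.Dart × Fin p)) (G.Dart × Fin p) ℝ :=
  Matrix.fromRows (-1) (-1)

/-- Oriented incidence matrix `E_o = A_s - A_d`. -/
def Eo : Matrix (G.Dart × Fin p) (Fin n × Fin p) ℝ := As G p - Ad G p

/-- Unoriented incidence matrix `E_u = A_s + A_d`. -/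
def Eu : Matrix (G.Dart × Fin p) (Fin n × Fin p) ℝ := As G p + Ad G p

/-- The smallest singular value `γ_u` of `E_u`: the last of the `np` singular values, which
Mathlib lists in decreasing order starting from the index `0`. -/
def gammaU : ℝ := (Matrix.toEuclideanLin (Eu G p)).singularValues (n * p - 1)

/-- The residual `A x + B z`. -/
def residual (x : NodeVec n p) (z : EdgeVec G p) : EdgePair G p :=
  Matrix.toEuclideanLin (A G p) x + Matrix.toEuclideanLin (B G p) z

/-- The block diagonal matrix `C = diag(c I, (1/c) I)`. -/
def C (c : ℝ) :
    Matrix ((G.Dart × Fin p) ⊕ (G.Dart × Fin p)) ((G.Dart × Fin p) ⊕ (G.Dart × Fin p)) ℝ :=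
  Matrix.fromBlocks (c • 1) 0 0 ((1 / c) • 1)

variable {G p}

/-- The weighted squared norm `‖u‖_C² = uᵀ C u`. -/
def normSqC (c : ℝ) (u : EdgePair G p) : ℝ := ⟪u, Matrix.toEuclideanLin (C G p c) u⟫_ℝ

/-- The augmented Lagrangian `f(x) + λᵀ(A x + B z) + (c/2) ‖A x + B z‖²`. -/
def augLagrangian (f : Fin n → EuclideanSpace ℝ (Fin p) → ℝ) (c : ℝ)
    (x : NodeVec n p) (z : EdgeVec G p) (l : EdgePair G p) : ℝ :=
  aggregate f x + ⟪l, residual G p x z⟫_ℝ + c / 2 * ‖residual G p x z‖ ^ 2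

/-- The quadratic approximation `F(x) + ∇F(x)ᵀ(y - x) + (1/2) (y - x)ᵀ ∇²F(x) (y - x)`, where the
Hessian is the derivative of the gradient. -/
def quadModel (F : NodeVec n p → ℝ) (x y : NodeVec n p) : ℝ :=
  F x + ⟪∇ F x, y - x⟫_ℝ + 1 / 2 * ⟪y - x, fderiv ℝ (∇ F) x (y - x)⟫_ℝ

/-- The DQM iteration: `x_{k+1}` minimizes the augmented Lagrangian at `(z_k, λ_k)` with `f`
replaced by its quadratic approximation at `x_k`, `z_{k+1}` minimizes the augmented Lagrangian
at `(x_{k+1}, λ_k)`, and `λ_{k+1} = λ_k + c (A x_{k+1} + B z_{k+1})`. -/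
structure IsDQM (f : Fin n → EuclideanSpace ℝ (Fin p) → ℝ) (c : ℝ)
    (x : ℕ → NodeVec n p) (z : ℕ → EdgeVec G p) (l : ℕ → EdgePair G p) : Prop where
  x_update : ∀ k, IsMinOn
    (fun y => quadModel (aggregate f) (x k) y + ⟪l k, residual G p y (z k)⟫_ℝ
      + c / 2 * ‖residual G p y (z k)‖ ^ 2) Set.univ (x (k + 1))
  z_update : ∀ k, IsMinOn (fun w => augLagrangian f c (x (k + 1)) w (l k)) Set.univ (z (k + 1))
  l_update : ∀ k, l (k + 1) = l k + c • residual G p (x (k + 1)) (z (k + 1))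

/-- The conditions on the initial vectors: `α_0 = -β_0`, `E_u x_0 = 2 z_0`, and `α_0` lies in the
column space of `E_o`. -/
structure InitialCondition (x₀ : NodeVec n p) (z₀ : EdgeVec G p) (l₀ : EdgePair G p) : Prop where
  alpha_eq : fstPart l₀ = -sndPart l₀
  x_z : Matrix.toEuclideanLin (Eu G p) x₀ = (2 : ℝ) • z₀
  alpha_mem : fstPart l₀ ∈ LinearMap.range (Matrix.toEuclideanLin (Eo G p))

/-- `α` is an optimal multiplier in the column space of `E_o`: it is the first component of some
`λ = [α; β]` for which the solution `(x, z)` minimizes the Lagrangian `ℒ(·, ·, λ)`. -/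
def IsOptimalMultiplier (f : Fin n → EuclideanSpace ℝ (Fin p) → ℝ) (c : ℝ)
    (x : NodeVec n p) (z : EdgeVec G p) (α : EdgeVec G p) : Prop :=
  (∃ β : EdgeVec G p, ∀ (x' : NodeVec n p) (z' : EdgeVec G p),
      augLagrangian f c x z (stack α β) ≤ augLagrangian f c x' z' (stack α β)) ∧
    α ∈ LinearMap.range (Matrix.toEuclideanLin (Eo G p))

end Matrices

/-- The function `g` on `ℝ^p` is twice differentiable, the eigenvalues of its Hessians lie in
`[m, M]`, and its Hessian is `L`-Lipschitz in operator norm. -/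
structure LocalAssumptions {p : ℕ} (m M L : ℝ) (g : EuclideanSpace ℝ (Fin p) → ℝ) : Prop where
  differentiable : Differentiable ℝ g
  differentiable_gradient : Differentiable ℝ (∇ g)
  hessian_lower : ∀ x v, m * ‖v‖ ^ 2 ≤ ⟪v, fderiv ℝ (∇ g) x v⟫_ℝ
  hessian_upper : ∀ x v, ⟪v, fderiv ℝ (∇ g) x v⟫_ℝ ≤ M * ‖v‖ ^ 2
  hessian_lipschitz : ∀ x y, ‖fderiv ℝ (∇ g) x - fderiv ℝ (∇ g) y‖ ≤ L * ‖x - y‖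

/-- `ζ_k = min {(L/2) ‖x_{k+1} - x_k‖, 2M}`. -/
def zeta {n p : ℕ} (L M : ℝ) (x : ℕ → NodeVec n p) (k : ℕ) : ℝ :=
  min (L / 2 * ‖x (k + 1) - x k‖) (2 * M)

/-- A nonnegative sequence converges Q-linearly to zero. -/
def QLinearToZero (b : ℕ → ℝ) : Prop :=
  (∀ k, 0 ≤ b k) ∧ ∃ ρ : ℝ, 0 < ρ ∧ ρ < 1 ∧ ∀ k, b (k + 1) ≤ ρ * b k

/-- A sequence converges R-linearly to zero: it is dominated by a nonnegative sequence that
converges Q-linearly to zero. -/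
def RLinearToZero (a : ℕ → ℝ) : Prop :=
  ∃ b : ℕ → ℝ, QLinearToZero b ∧ ∀ k, |a k| ≤ b k

end DQM

end

/-! The initial conditions make `β_k = -α_k` and `E_u x_k = 2 z_k` persist, so DQM becomes a
recurrence in `(x_k, z_k, α_k)` driven by the Taylor error `e_k` of the gradient. The first bound is
then `γ_u ‖v‖ ≤ ‖E_u v‖` with `E_u (x_k - x*) = 2 (z_k - z*)`; the `α` part of the norm only helps.

For the rate, let `D_k = ‖u_k - u*‖_C²`, `a = ‖x_{k+1} - x*‖`, `d = ‖x_{k+1} - x_k‖`. Testing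
stationarity on `x_{k+1} - x*` shows that `D_k - D_{k+1}` is at least `c/4 ‖E_u (x_{k+1} - x_k)‖² +
c/4 ‖E_o x_{k+1}‖² + m a² - ζ_k d a`. The condition on `c` absorbs the cross term for each `k`, but
without a gap uniform in `k`: one step only yields monotonicity and control of `E_o x_{k+1}`. The
uniform gap comes from two consecutive steps (`two_step_contraction`). They control `E_o (x_{k+2} -
x_{k+1})`, and `‖E_u v‖² + ‖E_o v‖² ≥ 2 γ_u² ‖v‖²` doubles the coefficient of `d²`. Conversely
`D_{k+1}` is at most a multiple of `a² + d²`, because `α - α*` lies in the range of `E_o`, where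
`E_oᵀ` is bounded below. Hence `D_{k+2} ≤ ρ D_k`. -/

noncomputable section

namespace DQM

/-! ### Gradient maps with bounded, Lipschitz Hessian. -/

section GradientMaps

variable {E : Type*} [NormedAddCommGroup E] [InnerProductSpace ℝ E]
  {g : E → E} {H : E → E →L[ℝ] E}

theorem hasDerivAt_comp_line (hg : ∀ x, HasFDerivAt g (H x) x) (y v : E) (t : ℝ) :
    HasDerivAt (fun s : ℝ => g (y + s • v)) (H (y + t • v) v) t := by
  have h : HasDerivAt (fun s : ℝ => y + s • v) v t := by
    simpa using ((hasDerivAt_id t).smul_const v).const_add y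
  exact (hg (y + t • v)).comp_hasDerivAt t h

theorem strongly_monotone_of_hessian_lower (hg : ∀ x, HasFDerivAt g (H x) x) {m : ℝ}
    (hm : ∀ x v, m * ‖v‖ ^ 2 ≤ ⟪v, H x v⟫_ℝ) (x y : E) :
    m * ‖x - y‖ ^ 2 ≤ ⟪x - y, g x - g y⟫_ℝ := by
  set v := x - y with hv
  have hd : ∀ t : ℝ, HasDerivAt (fun s : ℝ => ⟪v, g (y + s • v)⟫_ℝ - s * (m * ‖v‖ ^ 2))
      (⟪v, H (y + t • v) v⟫_ℝ - 1 * (m * ‖v‖ ^ 2)) t := fun t =>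
    ((innerSL ℝ v).hasFDerivAt.comp_hasDerivAt t (hasDerivAt_comp_line hg y v t)).sub
      ((hasDerivAt_id t).mul_const _)
  have hmono := monotone_of_deriv_nonneg (fun t => (hd t).differentiableAt) (fun t => by
    rw [(hd t).deriv]; linarith [hm (y + t • v) v])
  have h := hmono (zero_le_one' ℝ)
  have hx : y + v = x := by simp [hv]
  simp only [zero_smul, add_zero, zero_mul, sub_zero, one_smul, one_mul, hx] at h
  rw [inner_sub_right]
  linarith

/-- The norm of a symmetric operator is the supremum of its absolute Rayleigh quotients, so bounds
on the quadratic form suffice. -/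
theorem norm_apply_le_of_isSymmetric {T : E →L[ℝ] E} (hT : (T : E →ₗ[ℝ] E).IsSymmetric) {M : ℝ}
    (hM0 : 0 ≤ M) (hM : ∀ v, |⟪v, T v⟫_ℝ| ≤ M * ‖v‖ ^ 2) : ‖T‖ ≤ M := by
  rw [T.norm_eq_iSup_rayleighQuotient hT]
  refine ciSup_le fun v => ?_
  rcases eq_or_ne v 0 with rfl | hv
  · simpa using hM0
  · have hpos : 0 < ‖v‖ ^ 2 := by positivity
    rw [ContinuousLinearMap.rayleighQuotient, abs_div, abs_of_pos hpos, div_le_iff₀ hpos]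
    simpa [ContinuousLinearMap.reApplyInnerSelf_apply, real_inner_comm] using hM v

theorem norm_sub_le_of_hessian_norm_le (hg : ∀ x, HasFDerivAt g (H x) x) {M : ℝ}
    (hM : ∀ x, ‖H x‖ ≤ M) (x y : E) : ‖g x - g y‖ ≤ M * ‖x - y‖ :=
  convex_univ.norm_image_sub_le_of_norm_hasFDerivWithin_le
    (fun x _ => (hg x).hasFDerivWithinAt) (fun x _ => hM x) trivial trivial

theorem norm_taylor_le_of_hessian_lipschitz (hg : ∀ x, HasFDerivAt g (H x) x) {L : ℝ}
    (hL : ∀ x y, ‖H x - H y‖ ≤ L * ‖x - y‖) (x y : E) :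
    ‖g y - g x - H x (y - x)‖ ≤ L / 2 * ‖y - x‖ ^ 2 := by
  set v := y - x with hv
  have hd : ∀ t : ℝ, HasDerivAt (fun s : ℝ => g (x + s • v) - g x - s • H x v)
      (H (x + t • v) v - (1 : ℝ) • H x v) t := fun t =>
    ((hasDerivAt_comp_line hg x v t).sub_const _).sub ((hasDerivAt_id t).smul_const _)
  -- The mean value inequality against this majorant replaces the integral form of the remainder.
  have hB : ∀ t : ℝ, HasDerivAt (fun s : ℝ => L / 2 * ‖v‖ ^ 2 * s ^ 2) (L * ‖v‖ ^ 2 * t) t :=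
    fun t => ((hasDerivAt_pow 2 t).const_mul (L / 2 * ‖v‖ ^ 2)).congr_deriv (by push_cast; ring)
  have h := image_norm_le_of_norm_deriv_right_le_deriv_boundary (a := 0) (b := 1)
    (fun t _ => (hd t).continuousAt.continuousWithinAt)
    (fun t _ => (hd t).hasDerivWithinAt) (by simp) hB (fun t ht => ?_)
    (Set.right_mem_Icc.2 zero_le_one)
  · simpa [hv] using h
  · rw [one_smul, ← _root_.sub_apply]
    refine (ContinuousLinearMap.le_opNorm _ _).trans ?_
    have h1 := hL (x + t • v) x
    rw [add_sub_cancel_left, norm_smul, Real.norm_of_nonneg ht.1] at h1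
    nlinarith [mul_le_mul_of_nonneg_right h1 (norm_nonneg v)]

theorem hessian_isSymmetric [CompleteSpace E] {F : E → ℝ}
    (hF : ∀ x, HasGradientAt F (g x) x) (hg : ∀ x, HasFDerivAt g (H x) x) (x : E) :
    (H x : E →ₗ[ℝ] E).IsSymmetric := by
  intro v w
  have h := second_derivative_symmetric (𝕜 := ℝ) (f := F)
    (f' := fun y => InnerProductSpace.toDual ℝ E (g y))
    (f'' := (innerSL ℝ : E →L[ℝ] E →L[ℝ] ℝ).comp (H x)) (x := x)
    (fun y => (hF y).hasFDerivAt)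
    ((innerSL ℝ : E →L[ℝ] E →L[ℝ] ℝ).hasFDerivAt.comp x (hg x)) v w
  simp only [ContinuousLinearMap.comp_apply, innerSL_apply_apply] at h
  simpa [real_inner_comm] using h

end GradientMaps

theorem eq_zero_of_quadratic_nonneg {a b : ℝ} (h : ∀ t : ℝ, 0 ≤ t * a + t ^ 2 * b) : a = 0 := by
  by_contra ha
  have hb : 0 < |b| + 1 := by positivity
  -- At this `t` the quadratic equals `a² / (|b| + 1)²` times `b - (|b| + 1) < 0`.
  have h1 := h (-a / (|b| + 1))
  have h2 : -a / (|b| + 1) * a + (-a / (|b| + 1)) ^ 2 * b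
      = a ^ 2 / (|b| + 1) ^ 2 * (b - (|b| + 1)) := by field_simp; ring
  rw [h2] at h1
  have h3 : 0 < a ^ 2 / (|b| + 1) ^ 2 := by positivity
  nlinarith [le_abs_self b]

/-- Contraction by `ρ` every two steps, with monotonicity in between, gives the one-step rate `√ρ`.
Dividing `D 0` by `σ` makes the envelope equal `D 0` at index `1`, where only monotonicity is
available. -/
theorem rLinearToZero_of_two_step {D a : ℕ → ℝ} {K ρ : ℝ} (hK : 0 ≤ K) (hρ0 : 0 < ρ) (hρ1 : ρ < 1)
    (hD : ∀ k, D (k + 1) ≤ D k) (hD0 : 0 ≤ D 0) (hD2 : ∀ k, D (k + 2) ≤ ρ * D k)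
    (ha : ∀ k, |a k| ≤ K * D k) : RLinearToZero a := by
  set σ := √ρ with hσ
  have hσ0 : 0 < σ := Real.sqrt_pos.2 hρ0
  have hσ1 : σ < 1 := by rw [hσ, Real.sqrt_lt' one_pos]; simpa using hρ1
  have hσ2 : σ ^ 2 = ρ := Real.sq_sqrt hρ0.le
  have hbound : ∀ k, D k ≤ D 0 / σ * σ ^ k ∧ D (k + 1) ≤ D 0 / σ * σ ^ (k + 1) := by
    intro k
    induction k with
    | zero =>
      constructor
      · rw [pow_zero, mul_one, le_div_iff₀ hσ0]; nlinarith
      · rw [zero_add, pow_one, div_mul_cancel₀ _ hσ0.ne']; exact hD 0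
    | succ k ih =>
      refine ⟨ih.2, (hD2 k).trans ?_⟩
      calc ρ * D k ≤ ρ * (D 0 / σ * σ ^ k) := by gcongr; exact ih.1
        _ = D 0 / σ * σ ^ (k + 1 + 1) := by rw [← hσ2]; ring
  refine ⟨fun k => K * (D 0 / σ * σ ^ k), ⟨fun k => by positivity, σ, hσ0, hσ1, fun k => ?_⟩,
    fun k => (ha k).trans (mul_le_mul_of_nonneg_left (hbound k).1 hK)⟩
  exact le_of_eq (by ring)

/-! ### The abstract recurrence and its two-step contraction. -/

section Recurrence

variable {E Z : Type*} [NormedAddCommGroup E] [InnerProductSpace ℝ E] [FiniteDimensional ℝ E]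
  [NormedAddCommGroup Z] [InnerProductSpace ℝ Z] [FiniteDimensional ℝ Z]

/-- The kernel of the adjoint is orthogonal to the range, so the adjoint is injective there; in
finite dimension this gives a lower bound. -/
theorem exists_norm_le_norm_adjoint_of_mem_range (T : E →ₗ[ℝ] Z) :
    ∃ K : ℝ, 0 ≤ K ∧ ∀ y ∈ LinearMap.range T, ‖y‖ ≤ K * ‖T.adjoint y‖ := by
  have hker : LinearMap.ker (T.adjoint.domRestrict (LinearMap.range T)) = ⊥ := by
    rw [LinearMap.ker_eq_bot']
    rintro ⟨y, hy⟩ h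
    have h1 : y ∈ (LinearMap.range T)ᗮ := by
      rw [LinearMap.orthogonal_range]; exact h
    have h2 : ⟪y, y⟫_ℝ = 0 := h1 y hy
    exact Subtype.ext (inner_self_eq_zero.1 h2)
  obtain ⟨K, -, hK⟩ := LinearMap.exists_antilipschitzWith _ hker
  refine ⟨K, K.2, fun y hy => ?_⟩
  have := hK.le_mul_dist ⟨y, hy⟩ 0
  simpa [dist_eq_norm] using this

/-- A vector orthogonal to `ker T` lies in the range of `T.adjoint`; projecting its preimage onto
`range T` does not change the image under `T.adjoint`. -/
theorem exists_multiplier_of_orthogonal_ker (T : E →ₗ[ℝ] Z) {w : E}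
    (hw : ∀ v, T v = 0 → ⟪w, v⟫_ℝ = 0) :
    ∃ α ∈ LinearMap.range T, ∀ v, ⟪w, v⟫_ℝ + ⟪α, T v⟫_ℝ = 0 := by
  have h1 : w ∈ (LinearMap.ker T)ᗮ := fun v hv => by rw [real_inner_comm]; exact hw v hv
  rw [LinearMap.orthogonal_ker] at h1
  obtain ⟨a, ha⟩ := h1
  refine ⟨-(LinearMap.range T).starProjection a, neg_mem (Submodule.coe_mem _), fun v => ?_⟩
  have h2 : ⟪a - (LinearMap.range T).starProjection a, T v⟫_ℝ = 0 :=
    Submodule.starProjection_inner_eq_zero a _ (LinearMap.mem_range_self T v)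
  rw [← ha, LinearMap.adjoint_inner_left, inner_neg_left]
  rw [inner_sub_left] at h2
  linarith

theorem two_step_contraction
    {Eo Eu : E →ₗ[ℝ] Z} {c m M γ : ℝ} (hc : 0 < c) (hm : 0 < m) (hM : 0 ≤ M) (hγ : 0 < γ)
    (hEu : ∀ v, γ ^ 2 * ‖v‖ ^ 2 ≤ ‖Eu v‖ ^ 2)
    (hEuo : ∀ v, 2 * γ ^ 2 * ‖v‖ ^ 2 ≤ ‖Eu v‖ ^ 2 + ‖Eo v‖ ^ 2)
    {g : E → E} {x e : ℕ → E} {z α : ℕ → Z} {ζ : ℕ → ℝ} {xs : E} {zs αs : Z}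
    (hmono : ∀ y, m * ‖y - xs‖ ^ 2 ≤ ⟪y - xs, g y - g xs⟫_ℝ)
    (hlip : ∀ y, ‖g y - g xs‖ ≤ M * ‖y - xs‖)
    (he : ∀ k, ‖e k‖ ≤ ζ k * ‖x (k + 1) - x k‖)
    (he' : ∀ k, ‖e k‖ ≤ 2 * M * ‖x (k + 1) - x k‖)
    (hζ : ∀ k, ζ k ^ 2 ≤ m * c * γ ^ 2)
    (hz : ∀ k, Eu (x k) = (2 : ℝ) • z k) (hzs : Eu xs = (2 : ℝ) • zs) (hxs : Eo xs = 0)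
    (hα : ∀ k, α (k + 1) = α k + (c / 2) • Eo (x (k + 1)))
    (hα0 : α 0 ∈ LinearMap.range Eo) (hαs : αs ∈ LinearMap.range Eo)
    (hstat : ∀ k v, ⟪g (x (k + 1)) + e k, v⟫_ℝ + ⟪α (k + 1), Eo v⟫_ℝ
      + c * ⟪z (k + 1) - z k, Eu v⟫_ℝ = 0)
    (hkkt : ∀ v, ⟪g xs, v⟫_ℝ + ⟪αs, Eo v⟫_ℝ = 0)
    {D : ℕ → ℝ} (hD : ∀ k, D k = c * ‖z k - zs‖ ^ 2 + 1 / c * ‖α k - αs‖ ^ 2) :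
    (∀ k, D (k + 1) ≤ D k) ∧ ∃ ρ : ℝ, 0 < ρ ∧ ρ < 1 ∧ ∀ k, D (k + 2) ≤ ρ * D k := by
  have hzd : ∀ k, z (k + 1) - z k = (1 / 2 : ℝ) • Eu (x (k + 1) - x k) := fun k => by
    rw [map_sub, hz, hz, ← smul_sub, smul_smul]; norm_num
  have hzds : ∀ k, z k - zs = (1 / 2 : ℝ) • Eu (x k - xs) := fun k => by
    rw [map_sub, hz, hzs, ← smul_sub, smul_smul]; norm_num
  have hαd : ∀ k, α (k + 1) - α k = (c / 2) • Eo (x (k + 1) - xs) := fun k => by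
    rw [hα, map_sub, hxs]; simp
  have herr : ∀ k v, ⟪g (x (k + 1)) - g xs, v⟫_ℝ + ⟪e k, v⟫_ℝ + ⟪α (k + 1) - αs, Eo v⟫_ℝ
      + c * ⟪z (k + 1) - z k, Eu v⟫_ℝ = 0 := fun k v => by
    have h1 := hstat k v
    have h2 := hkkt v
    rw [inner_add_left] at h1
    rw [inner_sub_left, inner_sub_left]
    linarith
  -- Test `herr` on `x (k + 1) - xs` and turn the inner products of increments with errors into
  -- differences of squares.
  have hdec : ∀ k, D k - D (k + 1) = c / 4 * ‖Eu (x (k + 1) - x k)‖ ^ 2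
      + c / 4 * ‖Eo (x (k + 1))‖ ^ 2
      + ⟪g (x (k + 1)) - g xs, x (k + 1) - xs⟫_ℝ + ⟪e k, x (k + 1) - xs⟫_ℝ := fun k => by
    have h1 := herr k (x (k + 1) - xs)
    have hu : Eu (x (k + 1) - xs) = (2 : ℝ) • (z (k + 1) - zs) := by
      rw [hzds, smul_smul]; norm_num
    have ho : Eo (x (k + 1) - xs) = (2 / c) • (α (k + 1) - α k) := by
      rw [hαd, smul_smul]; field_simp; simp
    have hU : ‖Eu (x (k + 1) - x k)‖ ^ 2 = 4 * ‖z (k + 1) - z k‖ ^ 2 := by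
      rw [hzd, norm_smul, mul_pow]; norm_num; ring
    have hO : ‖Eo (x (k + 1))‖ ^ 2 = 4 / c ^ 2 * ‖α (k + 1) - α k‖ ^ 2 := by
      rw [hαd, map_sub, hxs, sub_zero, norm_smul, mul_pow, Real.norm_eq_abs, sq_abs]
      field_simp; norm_num
    rw [hu, ho, inner_smul_right, inner_smul_right] at h1
    have hz2 : ‖z k - zs‖ ^ 2 = ‖z (k + 1) - zs‖ ^ 2
        - 2 * ⟪z (k + 1) - z k, z (k + 1) - zs⟫_ℝ + ‖z (k + 1) - z k‖ ^ 2 := by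
      rw [show z k - zs = (z (k + 1) - zs) - (z (k + 1) - z k) by abel, norm_sub_sq_real,
        real_inner_comm]
    have hα2 : ‖α k - αs‖ ^ 2 = ‖α (k + 1) - αs‖ ^ 2
        - 2 * ⟪α (k + 1) - αs, α (k + 1) - α k⟫_ℝ + ‖α (k + 1) - α k‖ ^ 2 := by
      rw [show α k - αs = (α (k + 1) - αs) - (α (k + 1) - α k) by abel, norm_sub_sq_real]
    rw [hU, hO, hD, hD, hz2, hα2]
    linear_combination (norm := skip) -h1
    field_simp
    ring
  have hlow : ∀ k, c / 4 * ‖Eu (x (k + 1) - x k)‖ ^ 2 + c / 4 * ‖Eo (x (k + 1))‖ ^ 2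
      + m * ‖x (k + 1) - xs‖ ^ 2 - ζ k * ‖x (k + 1) - x k‖ * ‖x (k + 1) - xs‖
      ≤ D k - D (k + 1) := fun k => by
    rw [hdec]
    have h1 := hmono (x (k + 1))
    rw [real_inner_comm] at h1
    have h2 := (abs_le.1 (abs_real_inner_le_norm (e k) (x (k + 1) - xs))).1
    have h3 := mul_le_mul_of_nonneg_right (he k) (norm_nonneg (x (k + 1) - xs))
    linarith
  have hstep : ∀ k, c / 4 * ‖Eo (x (k + 1))‖ ^ 2 ≤ D k - D (k + 1) := fun k => by
    refine le_trans ?_ (hlow k)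
    have h1 := hEu (x (k + 1) - x k)
    set d := ‖x (k + 1) - x k‖
    set a := ‖x (k + 1) - xs‖
    -- Four times this is `(2ma - ζd)² + (mcγ² - ζ²)d²`: the hypothesis on `ζ` is exactly the
    -- discriminant condition.
    have h2 : 0 ≤ m * (c / 4 * (γ ^ 2 * d ^ 2) + m * a ^ 2 - ζ k * d * a) := by
      nlinarith [sq_nonneg (2 * m * a - ζ k * d), mul_le_mul_of_nonneg_right (hζ k) (sq_nonneg d)]
    have h3 := nonneg_of_mul_nonneg_right h2 hm
    nlinarith [mul_le_mul_of_nonneg_left h1 hc.le]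
  have hanti : ∀ k, D (k + 1) ≤ D k := fun k => by
    have : 0 ≤ c / 4 * ‖Eo (x (k + 1))‖ ^ 2 := by positivity
    linarith [hstep k]
  refine ⟨hanti, ?_⟩
  -- Now `d²` has coefficient `cγ²/2`. Spending `3/8` of `cγ²` and `2/3` of `m` on the cross term
  -- keeps the same discriminant condition and leaves `1/8` and `1/3`.
  have hdec2 : ∀ k, m / 3 * ‖x (k + 2) - xs‖ ^ 2 + c * γ ^ 2 / 8 * ‖x (k + 2) - x (k + 1)‖ ^ 2
      ≤ 3 * (D k - D (k + 2)) := fun k => by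
    have h0 := hlow (k + 1)
    have h1 := hEuo (x (k + 2) - x (k + 1))
    have h2 := hstep k
    have h3 := hstep (k + 1)
    have h4 : ‖Eo (x (k + 2) - x (k + 1))‖ ^ 2
        ≤ 2 * ‖Eo (x (k + 2))‖ ^ 2 + 2 * ‖Eo (x (k + 1))‖ ^ 2 := by
      rw [map_sub]
      have := parallelogram_law_with_norm ℝ (Eo (x (k + 2))) (Eo (x (k + 1)))
      nlinarith [sq_nonneg ‖Eo (x (k + 2)) + Eo (x (k + 1))‖]
    have h5 := hζ (k + 1)
    simp only [add_assoc, Nat.reduceAdd] at h0 h3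
    set d := ‖x (k + 2) - x (k + 1)‖
    set a := ‖x (k + 2) - xs‖
    -- 24 times this is `(4ma - 3ζd)² + 9(mcγ² - ζ²)d²`.
    have h6 : 0 ≤ m * (3 / 8 * (c * γ ^ 2) * d ^ 2 + 2 / 3 * m * a ^ 2 - ζ (k + 1) * d * a) := by
      nlinarith [sq_nonneg (4 * m * a - 3 * ζ (k + 1) * d),
        mul_le_mul_of_nonneg_right h5 (sq_nonneg d)]
    have h7 := nonneg_of_mul_nonneg_right h6 hm
    have h8 := mul_le_mul_of_nonneg_left h1 hc.le
    have h9 := mul_le_mul_of_nonneg_left h4 hc.le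
    have h10 : 0 ≤ c * ‖Eo (x (k + 2))‖ ^ 2 := by positivity
    have h11 : 0 ≤ c * ‖Eo (x (k + 1))‖ ^ 2 := by positivity
    linarith
  obtain ⟨K, hK0, hK⟩ := exists_norm_le_norm_adjoint_of_mem_range Eo
  set Eu' := LinearMap.toContinuousLinearMap Eu with hEu'
  have hG : ∀ v, ‖Eu v‖ ≤ ‖Eu'‖ * ‖v‖ := fun v => Eu'.le_opNorm v
  set Γ := ‖Eu'‖
  have hΓ : 0 ≤ Γ := norm_nonneg _
  have hαr : ∀ k, α k ∈ LinearMap.range Eo := fun k => by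
    induction k with
    | zero => exact hα0
    | succ k ih =>
      rw [hα]; exact add_mem ih (Submodule.smul_mem _ _ (LinearMap.mem_range_self _ _))
  have hαb : ∀ k, ‖α (k + 1) - αs‖ ≤ K * (M * ‖x (k + 1) - xs‖
      + (2 * M + c * (Γ * Γ / 2)) * ‖x (k + 1) - x k‖) := fun k => by
    refine (hK _ (sub_mem (hαr _) hαs)).trans (mul_le_mul_of_nonneg_left ?_ hK0)
    -- Testing stationarity on `y` itself produces `‖y‖²`; every other term is linear in `‖y‖`,
    -- which is then cancelled. The bound `2 * M` on the error keeps the constant independent of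
    -- `k`.
    set y := Eo.adjoint (α (k + 1) - αs) with hy
    have h1 := herr k y
    have h2 : ⟪α (k + 1) - αs, Eo y⟫_ℝ = ‖y‖ ^ 2 := by
      rw [← LinearMap.adjoint_inner_left, ← hy, real_inner_self_eq_norm_sq]
    rw [h2] at h1
    have h3 := (abs_le.1 (abs_real_inner_le_norm (g (x (k + 1)) - g xs) y)).1
    have h4 := (abs_le.1 (abs_real_inner_le_norm (e k) y)).1
    have h5 := (abs_le.1 (abs_real_inner_le_norm (z (k + 1) - z k) (Eu y))).1
    have h6 : ‖z (k + 1) - z k‖ * ‖Eu y‖ ≤ (Γ * Γ / 2) * ‖x (k + 1) - x k‖ * ‖y‖ := by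
      have : ‖z (k + 1) - z k‖ ≤ Γ / 2 * ‖x (k + 1) - x k‖ := by
        rw [hzd, norm_smul, Real.norm_of_nonneg (by norm_num)]
        linarith [hG (x (k + 1) - x k)]
      calc _ ≤ (Γ / 2 * ‖x (k + 1) - x k‖) * (Γ * ‖y‖) :=
            mul_le_mul this (hG y) (norm_nonneg _) (by positivity)
        _ = _ := by ring
    have h7 := mul_le_mul_of_nonneg_right (hlip (x (k + 1))) (norm_nonneg y)
    have h8 := mul_le_mul_of_nonneg_right (he' k) (norm_nonneg y)
    rcases (norm_nonneg y).eq_or_lt with h0 | h0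
    · rw [← h0]; positivity
    · refine le_of_mul_le_mul_right ?_ h0
      nlinarith [mul_le_mul_of_nonneg_left h6 hc.le, mul_le_mul_of_nonneg_left h5 hc.le]
  obtain ⟨P, hP, hDP⟩ : ∃ P : ℝ, 0 < P ∧ ∀ k, D (k + 1)
      ≤ P * (‖x (k + 1) - xs‖ ^ 2 + ‖x (k + 1) - x k‖ ^ 2) := by
    -- The final `+ 1` only makes `P` strictly positive.
    refine ⟨c * Γ ^ 2 / 4 + 1 / c * (K ^ 2 * (2 * M ^ 2 + 2 * (2 * M + c * (Γ * Γ / 2)) ^ 2)) + 1,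
      by positivity, fun k => ?_⟩
    have h1 : ‖z (k + 1) - zs‖ ^ 2 ≤ Γ ^ 2 / 4 * ‖x (k + 1) - xs‖ ^ 2 := by
      have h := pow_le_pow_left₀ (norm_nonneg _) (hG (x (k + 1) - xs)) 2
      rw [hzds, norm_smul, mul_pow]
      norm_num [-map_sub]
      linarith
    have h2 := pow_le_pow_left₀ (norm_nonneg _) (hαb k) 2
    set d := ‖x (k + 1) - x k‖
    set a := ‖x (k + 1) - xs‖
    set q := 2 * M + c * (Γ * Γ / 2)
    have h3 : (K * (M * a + q * d)) ^ 2 ≤ K ^ 2 * (2 * M ^ 2 + 2 * q ^ 2) * (a ^ 2 + d ^ 2) := by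
      have : (M * a + q * d) ^ 2 ≤ (2 * M ^ 2 + 2 * q ^ 2) * (a ^ 2 + d ^ 2) := by
        nlinarith [sq_nonneg (M * a - q * d), sq_nonneg (M * d), sq_nonneg (q * a)]
      rw [mul_pow, mul_assoc]
      exact mul_le_mul_of_nonneg_left this (sq_nonneg K)
    rw [hD]
    have h4 := mul_le_mul_of_nonneg_left h1 hc.le
    have h5 := mul_le_mul_of_nonneg_left (h2.trans h3) (one_div_pos.2 hc).le
    have h6 : 0 ≤ c * Γ ^ 2 / 4 * d ^ 2 := by positivity
    have h7 : 0 ≤ a ^ 2 + d ^ 2 := by positivity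
    nlinarith
  set κ := min (m / 3) (c * γ ^ 2 / 8) with hκ
  have hκ0 : 0 < κ := lt_min (by positivity) (by positivity)
  have hfin : ∀ k, D (k + 2) ≤ 3 * P / κ * (D k - D (k + 2)) := fun k => by
    refine (hDP (k + 1)).trans ?_
    have h1 := hdec2 k
    have h2 : κ * (‖x (k + 2) - xs‖ ^ 2 + ‖x (k + 2) - x (k + 1)‖ ^ 2) ≤ 3 * (D k - D (k + 2)) := by
      refine le_trans ?_ h1
      rw [mul_add]
      gcongr
      · exact min_le_left _ _
      · exact min_le_right _ _
    rw [div_mul_eq_mul_div, le_div_iff₀ hκ0]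
    nlinarith [mul_le_mul_of_nonneg_left h2 hP.le]
  have hR : 0 < 3 * P / κ := by positivity
  set R := 3 * P / κ
  -- Solving `D (k + 2) ≤ R * (D k - D (k + 2))` for `D (k + 2)`.
  refine ⟨R / (1 + R), by positivity, (div_lt_one (by positivity)).2 (by linarith), fun k => ?_⟩
  rw [div_mul_eq_mul_div, le_div_iff₀ (by positivity)]
  linarith [hfin k]

end Recurrence

/-! ### The aggregate objective inherits the local bounds. -/

section Aggregate

variable {n p : ℕ}

/-- The projection of the stacked node variables onto the copy of node `i`. -/
def nodeProj (i : Fin n) : NodeVec n p →L[ℝ] EuclideanSpace ℝ (Fin p) :=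
  LinearMap.toContinuousLinearMap
    { toFun := fun x => nodeBlock x i
      map_add' := fun _ _ => rfl
      map_smul' := fun _ _ => rfl }

theorem sum_norm_nodeProj_sq (x : NodeVec n p) : ∑ i, ‖nodeProj i x‖ ^ 2 = ‖x‖ ^ 2 := by
  simp only [EuclideanSpace.norm_sq_eq, Fintype.sum_prod_type]
  rfl

theorem norm_nodeProj_le (i : Fin n) (x : NodeVec n p) : ‖nodeProj i x‖ ≤ ‖x‖ := by
  refine le_of_sq_le_sq ?_ (norm_nonneg _)
  rw [← sum_norm_nodeProj_sq x]
  exact Finset.single_le_sum (f := fun i => ‖nodeProj i x‖ ^ 2) (fun _ _ => sq_nonneg _)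
    (Finset.mem_univ i)

theorem sum_norm_nodeProj_mul_le (x y : NodeVec n p) :
    ∑ i, ‖nodeProj i x‖ * ‖nodeProj i y‖ ≤ ‖x‖ * ‖y‖ := by
  refine le_of_sq_le_sq ?_ (by positivity)
  rw [mul_pow, ← sum_norm_nodeProj_sq x, ← sum_norm_nodeProj_sq y]
  exact Finset.sum_mul_sq_le_sq_mul_sq _ _ _

variable (f : Fin n → EuclideanSpace ℝ (Fin p) → ℝ)

/-- The gradient of the aggregate objective, assembled from the local gradients. -/
def aggregateGradient (x : NodeVec n p) : NodeVec n p :=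
  ∑ i, (nodeProj i).adjoint (∇ (f i) (nodeProj i x))

/-- The Hessian of the aggregate objective, assembled from the local Hessians. -/
def aggregateHessian (x : NodeVec n p) : NodeVec n p →L[ℝ] NodeVec n p :=
  ∑ i, (nodeProj i).adjoint ∘L fderiv ℝ (∇ (f i)) (nodeProj i x) ∘L nodeProj i

variable {f}

theorem hasGradientAt_aggregate (hf : ∀ i, Differentiable ℝ (f i)) (x : NodeVec n p) :
    HasGradientAt (aggregate f) (aggregateGradient f x) x := by
  rw [hasGradientAt_iff_hasFDerivAt]
  have h : HasFDerivAt (fun y : NodeVec n p => ∑ i, f i (nodeProj i y))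
      (∑ i, (fderiv ℝ (f i) (nodeProj i x)).comp (nodeProj i)) x :=
    HasFDerivAt.fun_sum fun i _ =>
      (hf i (nodeProj i x)).hasFDerivAt.comp x (nodeProj i).hasFDerivAt
  refine h.congr_fderiv ?_
  ext v
  simp [aggregateGradient, ContinuousLinearMap.adjoint_inner_left, inner_gradient_left]

theorem hasFDerivAt_aggregateGradient (hf : ∀ i, Differentiable ℝ (∇ (f i))) (x : NodeVec n p) :
    HasFDerivAt (aggregateGradient f) (aggregateHessian f x) x :=
  HasFDerivAt.fun_sum fun i _ => (nodeProj i).adjoint.hasFDerivAt.comp x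
    ((hf i (nodeProj i x)).hasFDerivAt.comp x (nodeProj i).hasFDerivAt)

theorem inner_aggregateHessian (x v w : NodeVec n p) : ⟪v, aggregateHessian f x w⟫_ℝ
    = ∑ i, ⟪nodeProj i v, fderiv ℝ (∇ (f i)) (nodeProj i x) (nodeProj i w)⟫_ℝ := by
  simp [aggregateHessian, inner_sum, ContinuousLinearMap.adjoint_inner_right]

variable {m M L : ℝ}

theorem aggregateHessian_lower (hf : ∀ i, LocalAssumptions m M L (f i)) (x v : NodeVec n p) :
    m * ‖v‖ ^ 2 ≤ ⟪v, aggregateHessian f x v⟫_ℝ := by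
  rw [inner_aggregateHessian, ← sum_norm_nodeProj_sq v, Finset.mul_sum]
  exact Finset.sum_le_sum fun i _ => (hf i).hessian_lower _ _

theorem aggregateHessian_upper (hf : ∀ i, LocalAssumptions m M L (f i)) (x v : NodeVec n p) :
    ⟪v, aggregateHessian f x v⟫_ℝ ≤ M * ‖v‖ ^ 2 := by
  rw [inner_aggregateHessian, ← sum_norm_nodeProj_sq v, Finset.mul_sum]
  exact Finset.sum_le_sum fun i _ => (hf i).hessian_upper _ _

theorem aggregateHessian_isSymmetric (hf : ∀ i, LocalAssumptions m M L (f i)) (x : NodeVec n p) :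
    (aggregateHessian f x : NodeVec n p →ₗ[ℝ] NodeVec n p).IsSymmetric :=
  hessian_isSymmetric (hasGradientAt_aggregate fun i => (hf i).differentiable)
    (hasFDerivAt_aggregateGradient fun i => (hf i).differentiable_gradient) x

theorem norm_aggregateHessian_le (hf : ∀ i, LocalAssumptions m M L (f i)) (hm : 0 ≤ m)
    (hM : 0 ≤ M) (x : NodeVec n p) : ‖aggregateHessian f x‖ ≤ M :=
  norm_apply_le_of_isSymmetric (aggregateHessian_isSymmetric hf x) hM fun v => by
    rw [abs_of_nonneg ((by positivity : 0 ≤ m * ‖v‖ ^ 2).trans (aggregateHessian_lower hf x v))]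
    exact aggregateHessian_upper hf x v

/-- The sign of `L` is not assumed: a negative `L` forces the local space to be trivial, and both
sides vanish. -/
theorem LocalAssumptions.lipschitz_mul_norm_le (hf : ∀ i, LocalAssumptions m M L (f i))
    (i : Fin n) (x : NodeVec n p) : L * ‖nodeProj i x‖ ≤ L * ‖x‖ := by
  rcases le_or_gt 0 L with hL | hL
  · exact mul_le_mul_of_nonneg_left (norm_nodeProj_le i x) hL
  · have hzero : ∀ y : EuclideanSpace ℝ (Fin p), ‖y‖ ≤ 0 := fun y => by
      have h := (norm_nonneg _).trans ((hf i).hessian_lipschitz y 0)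
      rw [sub_zero] at h
      nlinarith
    have hx : ‖x‖ ^ 2 ≤ 0 := by
      rw [← sum_norm_nodeProj_sq]
      exact Finset.sum_nonpos fun j _ => by
        nlinarith [hzero (nodeProj j x), norm_nonneg (nodeProj j x)]
    have hx0 : ‖x‖ = 0 := by nlinarith [norm_nonneg x]
    rw [hx0, mul_zero]
    exact mul_nonpos_of_nonpos_of_nonneg hL.le (norm_nonneg _)

theorem aggregateHessian_lipschitz (hf : ∀ i, LocalAssumptions m M L (f i)) (x y : NodeVec n p) :
    ‖aggregateHessian f x - aggregateHessian f y‖ ≤ L * ‖x - y‖ := by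
  rcases isEmpty_or_nonempty (Fin n) with hn | ⟨⟨i₀⟩⟩
  · have : Subsingleton (NodeVec n p) := inferInstance
    simp [Subsingleton.elim x y]
  have hL : 0 ≤ L * ‖x - y‖ := by
    refine le_trans ?_ (LocalAssumptions.lipschitz_mul_norm_le hf i₀ (x - y))
    rw [map_sub]
    exact (norm_nonneg _).trans ((hf i₀).hessian_lipschitz _ _)
  refine ContinuousLinearMap.opNorm_le_bound _ hL fun v => ?_
  set w := (aggregateHessian f x - aggregateHessian f y) v with hw
  -- Pairing with `w` splits the operator over the nodes; Cauchy–Schwarz over nodes reassembles the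
  -- norms without losing a factor `n`.
  have h1 : ‖w‖ ^ 2 ≤ L * ‖x - y‖ * (‖w‖ * ‖v‖) := by
    calc ‖w‖ ^ 2 = ⟪w, aggregateHessian f x v⟫_ℝ - ⟪w, aggregateHessian f y v⟫_ℝ := by
          rw [← real_inner_self_eq_norm_sq, ← inner_sub_right]; rfl
      _ = ∑ i, ⟪nodeProj i w, (fderiv ℝ (∇ (f i)) (nodeProj i x)
            - fderiv ℝ (∇ (f i)) (nodeProj i y)) (nodeProj i v)⟫_ℝ := by
          rw [inner_aggregateHessian, inner_aggregateHessian, ← Finset.sum_sub_distrib]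
          simp [inner_sub_right]
      _ ≤ ∑ i, L * ‖x - y‖ * (‖nodeProj i w‖ * ‖nodeProj i v‖) :=
          Finset.sum_le_sum fun i _ => by
            have h2 := (hf i).hessian_lipschitz (nodeProj i x) (nodeProj i y)
            rw [← map_sub] at h2
            have h3 := h2.trans (LocalAssumptions.lipschitz_mul_norm_le hf i (x - y))
            refine (real_inner_le_norm _ _).trans ?_
            refine (mul_le_mul_of_nonneg_left ((ContinuousLinearMap.le_opNorm _ _).trans
              (mul_le_mul_of_nonneg_right h3 (norm_nonneg _))) (norm_nonneg _)).trans_eq ?_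
            ring
      _ ≤ L * ‖x - y‖ * (‖w‖ * ‖v‖) := by
          rw [← Finset.mul_sum]
          exact mul_le_mul_of_nonneg_left (sum_norm_nodeProj_mul_le w v) hL
  rcases (norm_nonneg w).eq_or_lt with h0 | h0
  · rw [← h0]; positivity
  · exact le_of_mul_le_mul_right (by linarith) h0

end Aggregate

/-! ### The smallest singular value as a lower bound. -/

section SingularValues

/-- Expand in an eigenbasis of `T.adjoint ∘ₗ T`, whose eigenvalues are the squared singular values.
For `n = 0` the truncated index is harmless, since both sums are empty. -/
theorem sq_last_singularValue_mul_norm_sq_le {E F : Type*} [NormedAddCommGroup E]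
    [InnerProductSpace ℝ E] [FiniteDimensional ℝ E] [NormedAddCommGroup F] [InnerProductSpace ℝ F]
    [FiniteDimensional ℝ F] (T : E →ₗ[ℝ] F) {n : ℕ} (hn : Module.finrank ℝ E = n) (v : E) :
    T.singularValues (n - 1) ^ 2 * ‖v‖ ^ 2 ≤ ‖T v‖ ^ 2 := by
  set b := T.isSymmetric_adjoint_comp_self.eigenvectorBasis hn with hb
  have h1 : ‖T v‖ ^ 2 = ∑ i, ⟪v, b i⟫_ℝ * (T.singularValues i ^ 2 * ⟪b i, v⟫_ℝ) := by
    rw [← real_inner_self_eq_norm_sq, ← LinearMap.adjoint_inner_right,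
      ← b.sum_inner_mul_inner v (T.adjoint (T v))]
    refine Finset.sum_congr rfl fun i _ => ?_
    have h2 : ⟪b i, T.adjoint (T v)⟫_ℝ = ⟪(T.adjoint ∘ₗ T) (b i), v⟫_ℝ :=
      (T.isSymmetric_adjoint_comp_self (b i) v).symm
    rw [h2, hb, LinearMap.IsSymmetric.apply_eigenvectorBasis, inner_smul_left,
      T.sq_singularValues_fin hn]
    rfl
  have h3 : ‖v‖ ^ 2 = ∑ i, ⟪v, b i⟫_ℝ * ⟪b i, v⟫_ℝ := by
    rw [b.sum_inner_mul_inner, real_inner_self_eq_norm_sq]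
  rw [h1, h3, Finset.mul_sum]
  refine Finset.sum_le_sum fun i _ => ?_
  have h4 : T.singularValues (n - 1) ^ 2 ≤ T.singularValues i ^ 2 :=
    pow_le_pow_left₀ (T.singularValues_nonneg _)
      (T.singularValues_antitone (Nat.le_sub_one_of_lt i.2)) 2
  rw [real_inner_comm v (b i)]
  nlinarith [mul_le_mul_of_nonneg_right h4 (mul_self_nonneg ⟪b i, v⟫_ℝ)]

end SingularValues

/-! ### Incidence matrices, stacking, and the constant `γ_u`. -/

section Incidence

variable {n p : ℕ} {G : SimpleGraph (Fin n)}

theorem As_apply (x : NodeVec n p) (r : G.Dart × Fin p) :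
    Matrix.toEuclideanLin (As G p) x r = x (r.1.fst, r.2) := by
  simp only [Matrix.ofLp_toLpLin, Matrix.toLin'_apply, Matrix.mulVec, dotProduct, As,
    Matrix.of_apply]
  rw [Finset.sum_eq_single (r.1.fst, r.2)] <;> aesop

theorem Ad_apply (x : NodeVec n p) (r : G.Dart × Fin p) :
    Matrix.toEuclideanLin (Ad G p) x r = x (r.1.snd, r.2) := by
  simp only [Matrix.ofLp_toLpLin, Matrix.toLin'_apply, Matrix.mulVec, dotProduct, Ad,
    Matrix.of_apply]
  rw [Finset.sum_eq_single (r.1.snd, r.2)] <;> aesop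

theorem Eo_apply (x : NodeVec n p) : Matrix.toEuclideanLin (Eo G p) x
    = Matrix.toEuclideanLin (As G p) x - Matrix.toEuclideanLin (Ad G p) x := by
  rw [Eo, map_sub]; rfl

theorem Eu_apply (x : NodeVec n p) : Matrix.toEuclideanLin (Eu G p) x
    = Matrix.toEuclideanLin (As G p) x + Matrix.toEuclideanLin (Ad G p) x := by
  rw [Eu, map_add]; rfl

theorem feasible_iff (x : NodeVec n p) (z : EdgeVec G p) : Feasible x z ↔
    Matrix.toEuclideanLin (As G p) x = z ∧ Matrix.toEuclideanLin (Ad G p) x = z := by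
  constructor
  · intro h
    constructor <;> ext ⟨e, a⟩
    · rw [As_apply]; exact congrArg (fun y : EuclideanSpace ℝ (Fin p) => y a) (h e).1
    · rw [Ad_apply]; exact congrArg (fun y : EuclideanSpace ℝ (Fin p) => y a) (h e).2
  · rintro ⟨h1, h2⟩ e
    constructor <;> ext a
    · have := congrArg (fun y : EdgeVec G p => y (e, a)) h1
      simpa [As_apply, nodeBlock, edgeBlock] using this
    · have := congrArg (fun y : EdgeVec G p => y (e, a)) h2
      simpa [Ad_apply, nodeBlock, edgeBlock] using this

theorem stack_fstPart_sndPart (l : EdgePair G p) : stack (fstPart l) (sndPart l) = l := by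
  ext (r | r) <;> rfl

theorem stack_sub (v w v' w' : EdgeVec G p) :
    stack v w - stack v' w' = stack (v - v') (w - w') := by
  ext (r | r) <;> rfl

theorem stack_add (v w v' w' : EdgeVec G p) :
    stack v w + stack v' w' = stack (v + v') (w + w') := by
  ext (r | r) <;> rfl

theorem stack_smul (t : ℝ) (v w : EdgeVec G p) : t • stack v w = stack (t • v) (t • w) := by
  ext (r | r) <;> rfl

variable [DecidableRel G.Adj]

theorem residual_eq (x : NodeVec n p) (z : EdgeVec G p) : residual G p x z
    = stack (Matrix.toEuclideanLin (As G p) x - z) (Matrix.toEuclideanLin (Ad G p) x - z) := by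
  ext (r | r) <;>
    simp [residual, stack, A, B, Matrix.fromRows_mulVec, Matrix.neg_mulVec, sub_eq_add_neg]

theorem inner_stack (v w v' w' : EdgeVec G p) :
    ⟪stack v w, stack v' w'⟫_ℝ = ⟪v, v'⟫_ℝ + ⟪w, w'⟫_ℝ := by
  simp [PiLp.inner_apply, Fintype.sum_sum_type, stack]

theorem normSqC_stack (c : ℝ) (v w : EdgeVec G p) :
    normSqC c (stack v w) = c * ‖v‖ ^ 2 + 1 / c * ‖w‖ ^ 2 := by
  have h : Matrix.toEuclideanLin (C G p c) (stack v w) = stack (c • v) ((1 / c) • w) := by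
    ext (r | r) <;>
      simp [C, stack, Matrix.fromBlocks_mulVec, Matrix.smul_mulVec, Function.comp_def]
  rw [normSqC, h, inner_stack, inner_smul_right, inner_smul_right, real_inner_self_eq_norm_sq,
    real_inner_self_eq_norm_sq]

theorem gammaU_sq_mul_norm_sq_le (v : NodeVec n p) :
    gammaU G p ^ 2 * ‖v‖ ^ 2 ≤ ‖Matrix.toEuclideanLin (Eu G p) v‖ ^ 2 :=
  sq_last_singularValue_mul_norm_sq_le _ (by simp) v

/-- Test `E_u` on a coordinate vector. Darts have distinct endpoints, so the entries of `E_u` are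
`0` or `1` and equal their squares. -/
theorem gammaU_sq_le_degree (s : Fin n × Fin p) :
    gammaU G p ^ 2 ≤ ∑ r, (As G p r s + Ad G p r s) := by
  have h := gammaU_sq_mul_norm_sq_le (G := G) (EuclideanSpace.single s (1 : ℝ))
  rw [PiLp.norm_single, norm_one, one_pow, mul_one, EuclideanSpace.norm_sq_eq] at h
  refine h.trans_eq (Finset.sum_congr rfl fun r _ => ?_)
  have h1 : Matrix.toEuclideanLin (Eu G p) (EuclideanSpace.single s (1 : ℝ)) r
      = As G p r s + Ad G p r s := by
    simp [Eu]
  rw [h1, Real.norm_eq_abs, sq_abs]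
  have hne := r.1.adj.ne
  simp only [As, Ad, Matrix.of_apply]
  by_cases h2 : r.1.fst = s.1 ∧ r.2 = s.2
  · have h3 : ¬(r.1.snd = s.1 ∧ r.2 = s.2) := fun h3 => hne (h2.1.trans h3.1.symm)
    rw [if_pos h2, if_neg h3]; norm_num
  · rw [if_neg h2]; split_ifs <;> norm_num

theorem norm_As_sq (v : NodeVec n p) :
    ‖Matrix.toEuclideanLin (As G p) v‖ ^ 2 = ∑ s, (∑ r, As G p r s) * v s ^ 2 := by
  simp_rw [EuclideanSpace.norm_sq_eq, As_apply, Finset.sum_mul]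
  rw [Finset.sum_comm]
  refine Finset.sum_congr rfl fun r _ => ?_
  rw [Finset.sum_eq_single (r.1.fst, r.2)] <;> simp [As]; aesop

theorem norm_Ad_sq (v : NodeVec n p) :
    ‖Matrix.toEuclideanLin (Ad G p) v‖ ^ 2 = ∑ s, (∑ r, Ad G p r s) * v s ^ 2 := by
  simp_rw [EuclideanSpace.norm_sq_eq, Ad_apply, Finset.sum_mul]
  rw [Finset.sum_comm]
  refine Finset.sum_congr rfl fun r _ => ?_
  rw [Finset.sum_eq_single (r.1.snd, r.2)] <;> simp [Ad]; aesop

/-- By the parallelogram law the right side is `2 (‖A_s v‖² + ‖A_d v‖²)`, a diagonal form whose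
weights are twice the column sums bounded in `gammaU_sq_le_degree`. -/
theorem two_mul_gammaU_sq_mul_norm_sq_le (v : NodeVec n p) :
    2 * gammaU G p ^ 2 * ‖v‖ ^ 2 ≤ ‖Matrix.toEuclideanLin (Eu G p) v‖ ^ 2
      + ‖Matrix.toEuclideanLin (Eo G p) v‖ ^ 2 := by
  have h1 := parallelogram_law_with_norm ℝ (Matrix.toEuclideanLin (As G p) v)
    (Matrix.toEuclideanLin (Ad G p) v)
  have h2 : gammaU G p ^ 2 * ‖v‖ ^ 2 ≤ ‖Matrix.toEuclideanLin (As G p) v‖ ^ 2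
      + ‖Matrix.toEuclideanLin (Ad G p) v‖ ^ 2 := by
    rw [norm_As_sq, norm_Ad_sq, ← Finset.sum_add_distrib, EuclideanSpace.norm_sq_eq,
      Finset.mul_sum]
    refine Finset.sum_le_sum fun s _ => ?_
    rw [Real.norm_eq_abs, sq_abs, ← add_mul, ← Finset.sum_add_distrib]
    exact mul_le_mul_of_nonneg_right (gammaU_sq_le_degree s) (sq_nonneg _)
  rw [Eu_apply, Eo_apply]
  nlinarith

end Incidence

/-! ### Optimality conditions of DQM and the reduced recurrence. -/

section Iteration

variable {n p : ℕ} {G : SimpleGraph (Fin n)}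
  {f : Fin n → EuclideanSpace ℝ (Fin p) → ℝ} {m M L c : ℝ}

theorem eq_zero_of_isMinOn_of_expansion {V : Type*} [AddCommGroup V] [Module ℝ V] {φ : V → ℝ}
    {y v : V} {a b : ℝ} (hmin : IsMinOn φ Set.univ y)
    (hexp : ∀ t : ℝ, φ (y + t • v) = φ y + t * a + t ^ 2 * b) : a = 0 :=
  eq_zero_of_quadratic_nonneg fun t => by
    have h : φ y ≤ φ (y + t • v) := hmin (Set.mem_univ _)
    rw [hexp] at h
    linarith

theorem inner_add_penalty_expansion {Y : Type*} [NormedAddCommGroup Y] [InnerProductSpace ℝ Y]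
    (l r q : Y) (c t : ℝ) :
    ⟪l, r + t • q⟫_ℝ + c / 2 * ‖r + t • q‖ ^ 2 = ⟪l, r⟫_ℝ + c / 2 * ‖r‖ ^ 2
      + t * (⟪l, q⟫_ℝ + c * ⟪r, q⟫_ℝ) + t ^ 2 * (c / 2 * ‖q‖ ^ 2) := by
  rw [norm_add_sq_real, inner_add_right, inner_smul_right, inner_smul_right, norm_smul, mul_pow,
    Real.norm_eq_abs, sq_abs]
  ring

/-- Directions in the kernel of `E_o` preserve feasibility once `z` follows `A_s x`, so the
objective is stationary along them. -/
theorem IsSolution.inner_gradient_eq_zero (hf : ∀ i, Differentiable ℝ (f i))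
    {x : NodeVec n p} {z : EdgeVec G p} (h : IsSolution f x z) {v : NodeVec n p}
    (hv : Matrix.toEuclideanLin (Eo G p) v = 0) : ⟪aggregateGradient f x, v⟫_ℝ = 0 := by
  rw [Eo_apply, sub_eq_zero] at hv
  obtain ⟨h1, h2⟩ := (feasible_iff x z).1 h.1
  have hmin : ∀ t : ℝ, aggregate f x ≤ aggregate f (x + t • v) := fun t =>
    h.2 _ (Matrix.toEuclideanLin (As G p) (x + t • v)) ((feasible_iff _ _).2 ⟨rfl, by
      rw [map_add, map_add, map_smul, map_smul, h1, h2, hv]⟩)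
  have hline : HasDerivAt (fun t : ℝ => x + t • v) v 0 := by
    simpa using ((hasDerivAt_id (0 : ℝ)).smul_const v).const_add x
  have hd : HasDerivAt (fun t : ℝ => aggregate f (x + t • v)) ⟪aggregateGradient f x, v⟫_ℝ 0 := by
    have hF := (hasGradientAt_aggregate hf (x + (0 : ℝ) • v)).hasFDerivAt.comp_hasDerivAt 0 hline
    exact hF.congr_deriv (by simp)
  refine IsLocalMin.hasDerivAt_eq_zero (Filter.Eventually.of_forall fun t => ?_) hd
  simpa using hmin t

variable [DecidableRel G.Adj]

theorem IsDQM.x_stationary (hf : ∀ i, LocalAssumptions m M L (f i))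
    {x : ℕ → NodeVec n p} {z : ℕ → EdgeVec G p} {l : ℕ → EdgePair G p}
    (h : IsDQM f c x z l) (k : ℕ) (v : NodeVec n p) :
    ⟪aggregateGradient f (x k) + aggregateHessian f (x k) (x (k + 1) - x k), v⟫_ℝ
      + (⟪l k, stack (Matrix.toEuclideanLin (As G p) v) (Matrix.toEuclideanLin (Ad G p) v)⟫_ℝ
      + c * ⟪residual G p (x (k + 1)) (z k),
        stack (Matrix.toEuclideanLin (As G p) v) (Matrix.toEuclideanLin (Ad G p) v)⟫_ℝ) = 0 := by
  set Q := stack (Matrix.toEuclideanLin (As G p) v) (Matrix.toEuclideanLin (Ad G p) v) with hQ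
  have hgrad : ∇ (aggregate f) = aggregateGradient f :=
    gradient_eq (hasGradientAt_aggregate fun i => (hf i).differentiable)
  have hhess : fderiv ℝ (aggregateGradient f) (x k) = aggregateHessian f (x k) :=
    (hasFDerivAt_aggregateGradient (fun i => (hf i).differentiable_gradient) (x k)).fderiv
  have hres : ∀ t : ℝ, residual G p (x (k + 1) + t • v) (z k)
      = residual G p (x (k + 1)) (z k) + t • Q := fun t => by
    rw [residual_eq, residual_eq, hQ, stack_smul, stack_add, map_add, map_add, map_smul, map_smul]
    congr 1 <;> abel
  refine eq_zero_of_isMinOn_of_expansion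
    (b := 1 / 2 * ⟪v, aggregateHessian f (x k) v⟫_ℝ + c / 2 * ‖Q‖ ^ 2) (h.x_update k) (v := v)
    fun t => ?_
  -- Symmetry of the Hessian merges the two cross terms into the gradient of the quadratic model.
  have hsymm : ⟪v, aggregateHessian f (x k) (x (k + 1) - x k)⟫_ℝ
      = ⟪x (k + 1) - x k, aggregateHessian f (x k) v⟫_ℝ := by
    rw [real_inner_comm]; exact aggregateHessian_isSymmetric hf (x k) _ _
  simp only [quadModel, hgrad, hhess]
  rw [hres, add_assoc, inner_add_penalty_expansion, add_sub_right_comm, map_add, map_smul,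
    inner_add_right, inner_smul_right, inner_add_left, inner_add_right, inner_add_right,
    inner_smul_left, inner_smul_right, inner_smul_left, inner_smul_right, ← hsymm, inner_add_left,
    real_inner_comm v (aggregateHessian f (x k) (x (k + 1) - x k))]
  simp only [conj_trivial]
  ring

theorem IsDQM.z_stationary {x : ℕ → NodeVec n p} {z : ℕ → EdgeVec G p} {l : ℕ → EdgePair G p}
    (h : IsDQM f c x z l) (k : ℕ) :
    fstPart (l k) + sndPart (l k)
      + c • (Matrix.toEuclideanLin (Eu G p) (x (k + 1)) - (2 : ℝ) • z (k + 1)) = 0 := by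
  refine ext_inner_right ℝ fun w => ?_
  rw [inner_zero_left]
  have hres : ∀ t : ℝ, residual G p (x (k + 1)) (z (k + 1) + t • w)
      = residual G p (x (k + 1)) (z (k + 1)) + t • stack (-w) (-w) := fun t => by
    rw [residual_eq, residual_eq, stack_smul, stack_add, smul_neg]
    congr 1 <;> abel
  have h0 := eq_zero_of_isMinOn_of_expansion (h.z_update k) (v := w) fun t => by
    simp only [augLagrangian]
    rw [hres, add_assoc, inner_add_penalty_expansion, ← add_assoc, ← add_assoc, ← add_assoc]
  rw [← stack_fstPart_sndPart (l k), residual_eq, inner_stack, inner_stack] at h0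
  rw [Eu_apply, two_smul]
  simp only [inner_neg_right, inner_add_left, inner_sub_left, inner_smul_left,
    conj_trivial] at h0 ⊢
  linarith

theorem IsDQM.fstPart_succ {x : ℕ → NodeVec n p} {z : ℕ → EdgeVec G p} {l : ℕ → EdgePair G p}
    (h : IsDQM f c x z l) (k : ℕ) : fstPart (l (k + 1)) = fstPart (l k)
      + c • (Matrix.toEuclideanLin (As G p) (x (k + 1)) - z (k + 1)) := by
  rw [h.l_update, residual_eq]; rfl

theorem IsDQM.sndPart_succ {x : ℕ → NodeVec n p} {z : ℕ → EdgeVec G p} {l : ℕ → EdgePair G p}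
    (h : IsDQM f c x z l) (k : ℕ) : sndPart (l (k + 1)) = sndPart (l k)
      + c • (Matrix.toEuclideanLin (Ad G p) (x (k + 1)) - z (k + 1)) := by
  rw [h.l_update, residual_eq]; rfl

/-- The left side of `z_stationary` is precisely `α_{k+1} + β_{k+1}`. -/
theorem IsDQM.sndPart_eq_neg {x : ℕ → NodeVec n p} {z : ℕ → EdgeVec G p} {l : ℕ → EdgePair G p}
    (h : IsDQM f c x z l) (hinit : InitialCondition (x 0) (z 0) (l 0)) (k : ℕ) :
    sndPart (l k) = -fstPart (l k) := by
  cases k with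
  | zero => rw [hinit.alpha_eq, neg_neg]
  | succ k =>
    rw [← add_eq_zero_iff_eq_neg', h.fstPart_succ, h.sndPart_succ]
    refine Eq.trans ?_ (h.z_stationary k)
    rw [Eu_apply]
    module

theorem IsDQM.Eu_eq_two_smul (hc : c ≠ 0) {x : ℕ → NodeVec n p} {z : ℕ → EdgeVec G p}
    {l : ℕ → EdgePair G p} (h : IsDQM f c x z l) (hinit : InitialCondition (x 0) (z 0) (l 0))
    (k : ℕ) : Matrix.toEuclideanLin (Eu G p) (x k) = (2 : ℝ) • z k := by
  cases k with
  | zero => exact hinit.x_z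
  | succ k =>
    have h1 := h.z_stationary k
    rw [h.sndPart_eq_neg hinit, add_neg_cancel, zero_add] at h1
    exact sub_eq_zero.1 ((smul_eq_zero.1 h1).resolve_left hc)

theorem IsDQM.fstPart_succ_eq_add_Eo (hc : c ≠ 0) {x : ℕ → NodeVec n p} {z : ℕ → EdgeVec G p}
    {l : ℕ → EdgePair G p} (h : IsDQM f c x z l) (hinit : InitialCondition (x 0) (z 0) (l 0))
    (k : ℕ) : fstPart (l (k + 1))
      = fstPart (l k) + (c / 2) • Matrix.toEuclideanLin (Eo G p) (x (k + 1)) := by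
  have h1 : z (k + 1) = (1 / 2 : ℝ) • Matrix.toEuclideanLin (Eu G p) (x (k + 1)) := by
    rw [h.Eu_eq_two_smul hc hinit, smul_smul]; norm_num
  rw [h.fstPart_succ, h1, Eu_apply, Eo_apply]
  module

/-- Uses `A_sᵀA_s + A_dᵀA_d = (E_uᵀE_u + E_oᵀE_o)/2`: the `E_o` half advances `α_k` to `α_{k+1}`,
the `E_u` half turns `-z_k` into `z_{k+1} - z_k`. -/
theorem IsDQM.stationary_multiplier (hf : ∀ i, LocalAssumptions m M L (f i)) (hc : c ≠ 0)
    {x : ℕ → NodeVec n p} {z : ℕ → EdgeVec G p} {l : ℕ → EdgePair G p} (h : IsDQM f c x z l)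
    (hinit : InitialCondition (x 0) (z 0) (l 0)) (k : ℕ) (v : NodeVec n p) :
    ⟪aggregateGradient f (x k) + aggregateHessian f (x k) (x (k + 1) - x k), v⟫_ℝ
      + ⟪fstPart (l (k + 1)), Matrix.toEuclideanLin (Eo G p) v⟫_ℝ
      + c * ⟪z (k + 1) - z k, Matrix.toEuclideanLin (Eu G p) v⟫_ℝ = 0 := by
  have h1 := h.x_stationary hf k v
  have h2 : z (k + 1) = (1 / 2 : ℝ) • Matrix.toEuclideanLin (Eu G p) (x (k + 1)) := by
    rw [h.Eu_eq_two_smul hc hinit, smul_smul]; norm_num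
  rw [← stack_fstPart_sndPart (l k), residual_eq, inner_stack, inner_stack,
    h.sndPart_eq_neg hinit] at h1
  rw [h.fstPart_succ_eq_add_Eo hc hinit, h2, Eu_apply, Eu_apply, Eo_apply, Eo_apply]
  simp only [inner_neg_left, inner_add_left, inner_sub_left, inner_smul_left, inner_add_right,
    inner_sub_right, conj_trivial] at h1 ⊢
  linarith

theorem gammaU_sq_mul_norm_sub_sq_le {x xs : NodeVec n p} {z zs : EdgeVec G p}
    (hx : Matrix.toEuclideanLin (Eu G p) x = (2 : ℝ) • z)
    (hxs : Matrix.toEuclideanLin (Eu G p) xs = (2 : ℝ) • zs) :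
    gammaU G p ^ 2 * ‖x - xs‖ ^ 2 ≤ 4 * ‖z - zs‖ ^ 2 := by
  have h := gammaU_sq_mul_norm_sq_le (G := G) (x - xs)
  rw [map_sub, hx, hxs, ← smul_sub, norm_smul, mul_pow] at h
  norm_num at h
  exact h

theorem norm_sub_sq_le_normSqC (hc : 0 < c) (hγ : 0 < gammaU G p) {x xs : NodeVec n p}
    {z zs : EdgeVec G p} (hx : Matrix.toEuclideanLin (Eu G p) x = (2 : ℝ) • z)
    (hxs : Matrix.toEuclideanLin (Eu G p) xs = (2 : ℝ) • zs) (α αs : EdgeVec G p) :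
    ‖x - xs‖ ^ 2 ≤ 4 / (c * gammaU G p ^ 2) * normSqC c (stack z α - stack zs αs) := by
  have h1 := gammaU_sq_mul_norm_sub_sq_le hx hxs
  have h2 : 0 ≤ 1 / c * ‖α - αs‖ ^ 2 := by positivity
  rw [stack_sub, normSqC_stack, div_mul_eq_mul_div, le_div_iff₀ (by positivity)]
  nlinarith [mul_le_mul_of_nonneg_left h1 hc.le]

theorem IsDQM.rLinearToZero (hm : 0 < m) (hmM : m ≤ M) (hc : 0 < c)
    (hf : ∀ i, LocalAssumptions m M L (f i)) {xs : NodeVec n p} {zs : EdgeVec G p}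
    (hs : IsSolution f xs zs) {x : ℕ → NodeVec n p} {z : ℕ → EdgeVec G p} {l : ℕ → EdgePair G p}
    (hinit : InitialCondition (x 0) (z 0) (l 0)) (h : IsDQM f c x z l)
    (hγ : 0 < gammaU G p) (hζ : ∀ k, zeta L M x k ^ 2 / (m * gammaU G p ^ 2) < c) :
    RLinearToZero (fun k => ‖x k - xs‖ ^ 2) := by
  have hM : 0 ≤ M := hm.le.trans hmM
  obtain ⟨hs1, hs2⟩ := (feasible_iff xs zs).1 hs.1
  have hzs : Matrix.toEuclideanLin (Eu G p) xs = (2 : ℝ) • zs := by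
    rw [Eu_apply, hs1, hs2, two_smul]
  have hxs : Matrix.toEuclideanLin (Eo G p) xs = 0 := by rw [Eo_apply, hs1, hs2, sub_self]
  -- The multiplier is built from optimality of `xs`, so the convergence claim needs none as input.
  obtain ⟨αs, hαs, hkkt⟩ := exists_multiplier_of_orthogonal_ker
    (Matrix.toEuclideanLin (Eo G p)) fun v hv =>
      hs.inner_gradient_eq_zero (fun i => (hf i).differentiable) hv
  have hz := h.Eu_eq_two_smul hc.ne' hinit
  have hg := hasFDerivAt_aggregateGradient fun i => (hf i).differentiable_gradient
  have hHn := norm_aggregateHessian_le hf hm.le hM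
  set e : ℕ → NodeVec n p := fun k => aggregateGradient f (x k)
    + aggregateHessian f (x k) (x (k + 1) - x k) - aggregateGradient f (x (k + 1)) with he
  -- The two estimates of the Taylor error, here and in `heM`, are the two arguments of the minimum
  -- in `zeta`.
  have heL : ∀ k, ‖e k‖ ≤ L / 2 * ‖x (k + 1) - x k‖ * ‖x (k + 1) - x k‖ := fun k => by
    have h1 := norm_taylor_le_of_hessian_lipschitz hg (aggregateHessian_lipschitz hf)
      (x k) (x (k + 1))
    rw [← norm_neg] at h1
    rw [mul_assoc, ← sq]
    have h2 : e k = -(aggregateGradient f (x (k + 1)) - aggregateGradient f (x k)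
        - aggregateHessian f (x k) (x (k + 1) - x k)) := by simp only [he]; abel
    rw [h2]
    exact h1
  have heM : ∀ k, ‖e k‖ ≤ 2 * M * ‖x (k + 1) - x k‖ := fun k => by
    have h1 := norm_sub_le_of_hessian_norm_le hg hHn (x k) (x (k + 1))
    have h2 := (aggregateHessian f (x k)).le_of_opNorm_le (hHn (x k)) (x (k + 1) - x k)
    have h3 := norm_add_le (aggregateGradient f (x k) - aggregateGradient f (x (k + 1)))
      (aggregateHessian f (x k) (x (k + 1) - x k))
    rw [norm_sub_rev (x k)] at h1
    rw [sub_add_eq_add_sub] at h3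
    linarith
  obtain ⟨hanti, ρ, hρ0, hρ1, hρ⟩ := two_step_contraction (Eo := Matrix.toEuclideanLin (Eo G p))
    (Eu := Matrix.toEuclideanLin (Eu G p)) (γ := gammaU G p) (g := aggregateGradient f) (x := x)
    (e := e) (z := z) (α := fun k => fstPart (l k)) (ζ := zeta L M x) (xs := xs) (zs := zs)
    (αs := αs) (M := M) hc hm hM hγ gammaU_sq_mul_norm_sq_le two_mul_gammaU_sq_mul_norm_sq_le
    (fun y => strongly_monotone_of_hessian_lower hg (aggregateHessian_lower hf) y xs)
    (fun y => norm_sub_le_of_hessian_norm_le hg hHn y xs)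
    (fun k => by
      rw [zeta, min_mul_of_nonneg _ _ (norm_nonneg _)]
      exact le_min (heL k) (heM k))
    heM
    (fun k => by
      have h1 := (div_lt_iff₀ (by positivity)).1 (hζ k)
      linarith)
    hz hzs hxs (h.fstPart_succ_eq_add_Eo hc.ne' hinit) hinit.alpha_mem hαs
    (fun k v => by
      rw [← h.stationary_multiplier hf hc.ne' hinit k v, he]
      simp)
    hkkt
    (D := fun k => normSqC c (stack (z k) (fstPart (l k)) - stack zs αs))
    (fun k => by rw [stack_sub, normSqC_stack])
  refine rLinearToZero_of_two_step
    (D := fun k => normSqC c (stack (z k) (fstPart (l k)) - stack zs αs)) (K := 4 / (c * gammaU G p ^ 2)) (by positivity) hρ0 hρ1 hanti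
    ?_ hρ fun k => ?_
  · rw [stack_sub, normSqC_stack]
    positivity
  · rw [abs_of_nonneg (sq_nonneg _)]
    exact norm_sub_sq_le_normSqC hc hγ (hz k) hzs _ _

end Iteration

end DQM
end

theorem corollary1 {n p : ℕ} (G : SimpleGraph (Fin n)) [DecidableRel G.Adj] (hG : G.Connected)
    (f : Fin n → EuclideanSpace ℝ (Fin p) → ℝ)
    (m M L c : ℝ) (hm : 0 < m) (hmM : m ≤ M) (hc : 0 < c)
    (hf : ∀ i, DQM.LocalAssumptions m M L (f i))
    (xstar : DQM.NodeVec n p) (zstar : DQM.EdgeVec G p)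
    (hstar : DQM.IsSolution f xstar zstar)
    (x : ℕ → DQM.NodeVec n p) (z : ℕ → DQM.EdgeVec G p) (l : ℕ → DQM.EdgePair G p)
    (hinit : DQM.InitialCondition (x 0) (z 0) (l 0))
    (hDQM : DQM.IsDQM f c x z l)
    (hgamma : 0 < DQM.gammaU G p)
    (hzeta : ∀ k, DQM.zeta L M x k ^ 2 / (m * DQM.gammaU G p ^ 2) < c) :
    (∀ αstar : DQM.EdgeVec G p, DQM.IsOptimalMultiplier f c xstar zstar αstar →
      ∀ k, ‖x k - xstar‖ ^ 2 ≤ 4 / (c * DQM.gammaU G p ^ 2) *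
        DQM.normSqC c (DQM.stack (z k) (DQM.fstPart (l k)) - DQM.stack zstar αstar)) ∧
    DQM.RLinearToZero (fun k => ‖x k - xstar‖ ^ 2) := by
  obtain ⟨hs1, hs2⟩ := (DQM.feasible_iff xstar zstar).1 hstar.1
  have hzs : Matrix.toEuclideanLin (DQM.Eu G p) xstar = (2 : ℝ) • zstar := by
    rw [DQM.Eu_apply, hs1, hs2, two_smul]
  exact ⟨fun αstar _ k => DQM.norm_sub_sq_le_normSqC hc hgamma
      (hDQM.Eu_eq_two_smul hc.ne' hinit k) hzs _ _,
    hDQM.rLinearToZero hm hmM hc hf hstar hinit hgamma hzeta⟩
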